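/- Let $n\ge 3$ be an odd integer and let $\varphi\in C^{(n+3)/2}(\mathbb{R}^n)$ and $\psi\in C^{(n+1)/2}(\mathbb{R}^n)$ be real-valued functions (in particular, $\varphi,\psi$ may be arbitrary smooth functions). Let $d\sigma$ denote surface area measure on spheres, let $\omega_n$ be the surface area of the unit sphere of $\mathbb{R}^n$, and for $x\in\mathbb{R}^n$, $t>0$ let $$M_tf(x)=\frac{1}{\omega_n t^{n-1}}\int_{\partial B(x,t)}f(y)\,d\sigma(y)$$ be the mean of $f$ over the sphere of centre $x$ and radius $t$. Let $c_n^{-1}=(n-2)(n-4)\cdots 1$, and for $x\in\mathbb{R}^n$, $t>0$ put $$u(x,t)=c_n\,\frac{\partial}{\partial t}\Big(\frac1t\frac{\partial}{\partial t}\Big)^{(n-3)/2}\big(t^{n-2}M_t\varphi(x)\big)+c_n\Big(\frac1t\frac{\partial}{\partial t}\Big)^{(n-3)/2}\big(t^{n-2}M_t\psi(x)\big).$$ Then: (1) The derivatives in this formula exist in the classical sense: for each $x$, the function $t\mapsto t^{n-2}M_t\varphi(x)$ is of class $C^{(n-1)/2}$ on $(0,\infty)$, and $t\mapsto t^{n-2}M_t\psi(x)$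 is of class $C^{(n-3)/2}$ on $(0,\infty)$. (2) $u$ is of class $C^2$ on the open half-space $\{(x,t): x\in\mathbb{R}^n,\ t>0\}$ and satisfies there $u_{tt}=\nabla^2u$, where $\nabla^2=\sum_{i=1}^n\partial^2/\partial x_i^2$. (3) $u$ takes the initial values $u(\cdot,0)=\varphi$ and $u_t(\cdot,0)=\psi$ in the following sense. For every $x_0\in\mathbb{R}^n$, $u(x,t)\to\varphi(x_0)$ and $u_t(x,t)\to\psi(x_0)$ as $(x,t)\to(x_0,0)$ with $t>0$. Moreover, $u$ extends to a $C^2$ function on the closed half-space $\{t\ge0\}$ whose value at $(x,0)$ is $\varphi(x)$ and whose one-sided $t$-derivative at $(x,0)$ is $\psi(x)$, for every $x\in\mathbb{R}^n$. (4) When $n=3$ the formula reduces to Kirchhoff's formula: for all $x\in\mathbb{R}^3$ and $t>0$, $$u(x,t)=\frac{\partial}{\partial t}\Big(\frac{1}{4\pi t}\int_{\partial B(x,t)}\varphi\,d\sigma\Big)+\frac{1}{4\pi t}\int_{\partial B(x,t)}\psi\,d\sigma=\frac{1}{4\pi t^2}\int_{\partial B(x,t)}\big(t\,\psi(y)+\varphi(y)+\nabla\varphi(y)\cdot(y-x)\big)\,d\sigma(y).$$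 -/

import Mathlib

open MeasureTheory Set Filter Topology

noncomputable section

/-- The surface area `ω_n` of the unit sphere of `ℝⁿ`. -/
def unitSphereArea (n : ℕ) : ℝ :=
  ((volume : Measure (EuclideanSpace ℝ (Fin n))).toSphere).real univ

/-- The surface area measure `dσ` carried by the sphere `∂B(x, R)` of `ℝⁿ`, `R > 0`, as a measure
on `ℝⁿ`: the image of the surface measure of the unit sphere under `ω ↦ x + R ω`, times
`R ^ (n - 1)`. -/
def sphereSurfaceMeasure {n : ℕ} (x : EuclideanSpace ℝ (Fin n)) (R : ℝ) :
    Measure (EuclideanSpace ℝ (Fin n)) :=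
  ENNReal.ofReal (R ^ (n - 1)) •
    Measure.map
      (fun ω : Metric.sphere (0 : EuclideanSpace ℝ (Fin n)) 1 =>
        x + R • (ω : EuclideanSpace ℝ (Fin n)))
      (volume : Measure (EuclideanSpace ℝ (Fin n))).toSphere

/-- The spherical mean `M_R f (x) = (1 / (ω_n R ^ (n - 1))) ∫_{∂B(x, R)} f dσ`, `R > 0`. -/
def sphericalMean {n : ℕ} (R : ℝ) (f : EuclideanSpace ℝ (Fin n) → ℝ)
    (x : EuclideanSpace ℝ (Fin n)) : ℝ :=
  (unitSphereArea n * R ^ (n - 1))⁻¹ * ∫ y, f y ∂(sphereSurfaceMeasure x R)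

/-- The operator `(1 / t) ∂/∂t` on functions of `t > 0`. -/
def invMulDeriv (f : ℝ → ℝ) : ℝ → ℝ := fun t => t⁻¹ * deriv f t

/-- The constant `c_n`, with `c_n⁻¹ = (n - 2) (n - 4) ⋯ 1` for odd `n ≥ 3`. -/
def waveConst (n : ℕ) : ℝ := ((Nat.doubleFactorial (n - 2) : ℕ) : ℝ)⁻¹

/-- The function
`u(x, t) = c_n ∂_t ((1/t) ∂_t)^{(n-3)/2} (t^{n-2} M_t φ (x))
  + c_n ((1/t) ∂_t)^{(n-3)/2} (t^{n-2} M_t ψ (x))`, for `t > 0` and odd `n ≥ 3`. -/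
def waveSolution {n : ℕ} (φ ψ : EuclideanSpace ℝ (Fin n) → ℝ)
    (x : EuclideanSpace ℝ (Fin n)) (t : ℝ) : ℝ :=
  waveConst n *
      deriv (invMulDeriv^[(n - 3) / 2] (fun s : ℝ => s ^ (n - 2) * sphericalMean s φ x)) t +
    waveConst n *
      (invMulDeriv^[(n - 3) / 2] (fun s : ℝ => s ^ (n - 2) * sphericalMean s ψ x)) t

end

/-! Write `M` for the mean of `f (x + t ω)` over the unit sphere. In this form `M` makes sense for
every real `t` and is as smooth in `(x, t)` as `f`, so nothing is singular at `t = 0`. Rotation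
invariance of the surface measure gives Darboux's equation `t M_tt + (n - 1) M_t = t ∇² M`
(`darboux_centeredMean`), the Euler–Poisson–Darboux equation with parameter `a = n - 1`.

If `w` solves that equation with parameter `a`, then `(a - 1) w + t w_t` solves it with parameter `a
- 2` (`SolvesEPD.radialShift`). This is what `(1/t) ∂_t` does to `t ^ (a - 1) w`, up to the factor
`t ^ (a - 3)`. For odd `n`, after `(n - 3) / 2` steps the parameter is `2` and the power of `t` is
`1`; and `a = 2` says exactly that `t w` solves the wave equation (`SolvesEPD.wave`).

Each step multiplies the value at `t = 0` by `a - 1`, and `c_n` is the inverse of the product of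
these factors. Hence `K_f = c_n t w` is a wave with `K_f = 0`, `∂_t K_f = f` and `∂_t² K_f = c_n t
∇² w = 0` at `t = 0`. So `∂_t K_φ + K_ψ` is a wave with data `φ`, `ψ`. It is `C²` on all of
space-time and equals `u` for `t > 0`, so the limits and the extension to the closed half-space
follow from its continuity and differentiability across `t = 0`. -/

noncomputable section

/-! ### Calculus of directional derivatives. -/

section DirDeriv

variable {P V : Type*} [NormedAddCommGroup P] [NormedSpace ℝ P]
  [NormedAddCommGroup V] [NormedSpace ℝ V]

/-- The derivative of `h` in the direction `v`. -/
def dirDeriv (v : P) (h : P → V) : P → V := fun p => fderiv ℝ h p v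

theorem ContDiff.dirDeriv {r s : ℕ} {h : P → V} (hh : ContDiff ℝ s h) (hrs : r + 1 ≤ s) (v : P) :
    ContDiff ℝ r (dirDeriv v h) :=
  (hh.fderiv_right (by exact_mod_cast hrs)).clm_apply contDiff_const

theorem dirDeriv_add {h₁ h₂ : P → V} (hh₁ : Differentiable ℝ h₁) (hh₂ : Differentiable ℝ h₂)
    (v : P) : dirDeriv v (fun p => h₁ p + h₂ p) = fun p => dirDeriv v h₁ p + dirDeriv v h₂ p := by
  ext p
  simp [dirDeriv, fderiv_fun_add (hh₁ p) (hh₂ p)]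

theorem dirDeriv_mul {h₁ h₂ : P → ℝ} (hh₁ : Differentiable ℝ h₁) (hh₂ : Differentiable ℝ h₂)
    (v : P) : dirDeriv v (fun p => h₁ p * h₂ p) =
      fun p => h₁ p * dirDeriv v h₂ p + h₂ p * dirDeriv v h₁ p := by
  ext p
  simp [dirDeriv, fderiv_fun_mul (hh₁ p) (hh₂ p)]

theorem dirDeriv_const_mul {h : P → ℝ} (hh : Differentiable ℝ h) (c : ℝ) (v : P) :
    dirDeriv v (fun p => c * h p) = fun p => c * dirDeriv v h p := by
  ext p
  simp [dirDeriv, fderiv_const_mul (hh p)]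

theorem dirDeriv_sum {ι : Type*} (s : Finset ι) {h : ι → P → V}
    (hh : ∀ i, Differentiable ℝ (h i)) (v : P) :
    dirDeriv v (fun p => ∑ i ∈ s, h i p) = fun p => ∑ i ∈ s, dirDeriv v (h i) p := by
  ext p
  simp [dirDeriv, fderiv_fun_sum (fun i _ => hh i p)]

theorem dirDeriv_dirDeriv_apply {h : P → V} (hh : ContDiff ℝ 2 h) (v w p : P) :
    dirDeriv v (dirDeriv w h) p = fderiv ℝ (fderiv ℝ h) p v w := by
  have h1 : DifferentiableAt ℝ (fderiv ℝ h) p :=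
    (hh.fderiv_right (m := 1) (by norm_num)).differentiable (by norm_num) p
  unfold dirDeriv
  rw [fderiv_clm_apply h1 (differentiableAt_const _)]
  simp

theorem dirDeriv_comm {h : P → V} (hh : ContDiff ℝ 2 h) (v w : P) :
    dirDeriv v (dirDeriv w h) = dirDeriv w (dirDeriv v h) := by
  ext p
  rw [dirDeriv_dirDeriv_apply hh, dirDeriv_dirDeriv_apply hh]
  exact (hh.contDiffAt.isSymmSndFDerivAt (by simp)) v w

end DirDeriv

/-! ### Differentiation under the integral over a compact space, in particular the sphere. -/

section Parametric

variable {P V K : Type*} [NormedAddCommGroup P] [NormedSpace ℝ P] [ProperSpace P]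
  [NormedAddCommGroup V]
  [TopologicalSpace K] [CompactSpace K] [T2Space K] [SecondCountableTopology K]
  [MeasurableSpace K] [BorelSpace K]

theorem Continuous.integrable_of_compactSpace {μ : Measure K} [IsFiniteMeasure μ] {f : K → V}
    (hf : Continuous f) : Integrable f μ :=
  hf.integrable_of_hasCompactSupport (HasCompactSupport.of_compactSpace f)

/-- A closed ball of parameters times `K` is compact, so the continuous derivative is bounded there;
that constant dominates because the measure is finite. -/
theorem hasFDerivAt_integral_of_continuous_of_compactSpace [NormedSpace ℝ V] {μ : Measure K} [IsFiniteMeasure μ]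
    {F : P → K → V} {F' : P → K → P →L[ℝ] V} (hF : ∀ p, Continuous (F p))
    (hF' : Continuous (Function.uncurry F')) (h : ∀ p k, HasFDerivAt (F · k) (F' p k) p) (p : P) :
    HasFDerivAt (fun q => ∫ k, F q k ∂μ) (∫ k, F' p k ∂μ) p := by
  obtain ⟨C, hC⟩ := ((isCompact_closedBall p 1).prod
    (isCompact_univ (X := K))).exists_bound_of_continuousOn hF'.continuousOn
  refine hasFDerivAt_integral_of_dominated_of_fderiv_le (s := Metric.closedBall p 1)
    (bound := fun _ => C) (Metric.closedBall_mem_nhds p one_pos)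
    (Eventually.of_forall fun q => (hF q).aestronglyMeasurable)
    (hF p).integrable_of_compactSpace
    (hF'.comp (Continuous.prodMk_right p)).aestronglyMeasurable
    (Eventually.of_forall fun k q hq => hC (q, k) ⟨hq, mem_univ _⟩)
    (integrable_const _) (Eventually.of_forall fun k q _ => h q k)

end Parametric

section SphereIntegral

variable {E : Type} [NormedAddCommGroup E] [NormedSpace ℝ E] [FiniteDimensional ℝ E]
  [MeasurableSpace E] [BorelSpace E] {μ : Measure (Metric.sphere (0 : E) 1)} [IsFiniteMeasure μ]
  {P V : Type} [NormedAddCommGroup P] [NormedSpace ℝ P] [FiniteDimensional ℝ P]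
  [NormedAddCommGroup V] [NormedSpace ℝ V]

theorem hasFDerivAt_integral_sphere {F : P × E → V} (hF : ContDiff ℝ 1 F) (p : P) :
    HasFDerivAt (fun q => ∫ ω : Metric.sphere (0 : E) 1, F (q, ω) ∂μ)
      (∫ ω : Metric.sphere (0 : E) 1,
        (fderiv ℝ F (p, ω)).comp (ContinuousLinearMap.inl ℝ P E) ∂μ) p := by
  have : ProperSpace P := FiniteDimensional.proper ℝ P
  have : ProperSpace E := FiniteDimensional.proper ℝ E
  have hc := hF.continuous_fderiv (by norm_num)
  refine hasFDerivAt_integral_of_continuous_of_compactSpace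
    (F := fun q (ω : Metric.sphere (0 : E) 1) => F (q, ω))
    (F' := fun q (ω : Metric.sphere (0 : E) 1) =>
      (fderiv ℝ F (q, ω)).comp (ContinuousLinearMap.inl ℝ P E)) ?_ ?_ ?_ p
  · intro q
    exact hF.continuous.comp (by fun_prop)
  · exact (hc.comp (by fun_prop :
      Continuous fun x : P × Metric.sphere (0 : E) 1 => (x.1, (x.2 : E)))).clm_comp continuous_const
  · intro q ω
    exact (hF.differentiable (by norm_num) (q, (ω : E))).hasFDerivAt.comp q
      (hasFDerivAt_prodMk_left q (ω : E))

/-- The derivative is again a sphere integral, now with values in `P →L[ℝ] V`; the induction on `r`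
therefore has to let the codomain vary. -/
theorem contDiff_integral_sphere (r : ℕ) :
    ∀ {V : Type} [NormedAddCommGroup V] [NormedSpace ℝ V] {F : P × E → V}, ContDiff ℝ r F →
      ContDiff ℝ r fun q => ∫ ω : Metric.sphere (0 : E) 1, F (q, ω) ∂μ := by
  have : ProperSpace P := FiniteDimensional.proper ℝ P
  have : ProperSpace E := FiniteDimensional.proper ℝ E
  induction r with
  | zero =>
    intro V _ _ F hF
    have hc := hF.continuous
    refine contDiff_zero.2 (continuous_iff_continuousAt.2 fun p => ?_)
    obtain ⟨C, hC⟩ := ((isCompact_closedBall p 1).prod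
      (isCompact_sphere (0 : E) 1)).exists_bound_of_continuousOn hc.continuousOn
    refine continuousAt_of_dominated (bound := fun _ => C)
      (Eventually.of_forall fun q => Continuous.aestronglyMeasurable (hc.comp (by fun_prop))) ?_
      (integrable_const _) (Eventually.of_forall fun ω =>
        (hc.comp (by fun_prop : Continuous fun q : P => (q, (ω : E)))).continuousAt)
    filter_upwards [Metric.closedBall_mem_nhds p one_pos] with q hq
    exact Eventually.of_forall fun ω => hC (q, ω) ⟨hq, ω.2⟩
  | succ r ih =>
    intro V _ _ F hF
    have h1 : ContDiff ℝ 1 F := hF.of_le (by exact_mod_cast Nat.le_add_left 1 r)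
    refine contDiff_succ_iff_hasFDerivAt.2 ⟨_, ?_, hasFDerivAt_integral_sphere h1⟩
    exact ih (F := fun x => (fderiv ℝ F x).comp (ContinuousLinearMap.inl ℝ P E))
      ((hF.fderiv_right (m := r) (by norm_cast)).clm_comp contDiff_const)

theorem dirDeriv_integral_sphere {F : P × E → V} (hF : ContDiff ℝ 1 F) (v p : P) :
    dirDeriv v (fun q => ∫ ω : Metric.sphere (0 : E) 1, F (q, ω) ∂μ) p =
      ∫ ω : Metric.sphere (0 : E) 1, dirDeriv v (fun q => F (q, ω)) p ∂μ := by
  have : ProperSpace E := FiniteDimensional.proper ℝ E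
  have hc := hF.continuous_fderiv (by norm_num)
  unfold dirDeriv
  rw [(hasFDerivAt_integral_sphere hF p).fderiv, ContinuousLinearMap.integral_apply]
  · refine integral_congr_ae (Eventually.of_forall fun ω => ?_)
    have : HasFDerivAt (fun q => F (q, ω))
        ((fderiv ℝ F (p, ω)).comp (ContinuousLinearMap.inl ℝ P E)) p :=
      (hF.differentiable (by norm_num) (p, (ω : E))).hasFDerivAt.comp p
        (hasFDerivAt_prodMk_left p (ω : E))
    simp only [this.fderiv]
  · exact Continuous.integrable_of_compactSpace
      ((hc.comp (by fun_prop)).clm_comp continuous_const)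

end SphereIntegral

/-! ### Invariance of the surface measure under isometries. -/

section Rotation

variable {E : Type*} [NormedAddCommGroup E] [InnerProductSpace ℝ E] [FiniteDimensional ℝ E]
  [MeasurableSpace E] [BorelSpace E]

open scoped Pointwise

/-- The action of a linear isometry on the unit sphere. -/
def LinearIsometryEquiv.onSphere (R : E ≃ₗᵢ[ℝ] E) (ω : Metric.sphere (0 : E) 1) :
    Metric.sphere (0 : E) 1 := ⟨R ω, by simp⟩

/-- The surface measure of `s` is the dimension times the volume of the cone over `s`, and `R`
preserves volume and pulls cones back to cones. -/
theorem LinearIsometryEquiv.measurePreserving_onSphere (R : E ≃ₗᵢ[ℝ] E) :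
    MeasurePreserving R.onSphere (volume : Measure E).toSphere (volume : Measure E).toSphere := by
  have hm : Measurable R.onSphere :=
    ((R.continuous.comp continuous_subtype_val).subtype_mk _).measurable
  refine ⟨hm, Measure.ext fun s hs => ?_⟩
  rw [Measure.map_apply hm hs, Measure.toSphere_apply' _ (hm hs), Measure.toSphere_apply' _ hs]
  congr 1
  have : Ioo (0 : ℝ) 1 • (Subtype.val '' (R.onSphere ⁻¹' s)) =
      R ⁻¹' (Ioo (0 : ℝ) 1 • (Subtype.val '' s)) := by
    ext x
    simp only [Set.mem_smul, mem_preimage]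
    constructor
    · rintro ⟨c, hc, _, ⟨ω, hω, rfl⟩, rfl⟩
      exact ⟨c, hc, _, ⟨_, hω, rfl⟩, (R.map_smul c (ω : E)).symm⟩
    · rintro ⟨c, hc, _, ⟨ω, hω, rfl⟩, hx⟩
      refine ⟨c, hc, R.symm ω, ⟨⟨R.symm ω, by simp⟩, ?_, rfl⟩, ?_⟩
      · simpa [LinearIsometryEquiv.onSphere] using hω
      · apply R.injective
        simp [hx]
  rw [this]
  exact R.measurePreserving.measure_preimage_emb R.toHomeomorph.measurableEmbedding _

theorem LinearIsometryEquiv.integral_comp_sphere (R : E ≃ₗᵢ[ℝ] E) {g : E → ℝ} (hg : Continuous g) :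
    ∫ ω : Metric.sphere (0 : E) 1, g (R ω) ∂(volume : Measure E).toSphere =
      ∫ ω : Metric.sphere (0 : E) 1, g ω ∂(volume : Measure E).toSphere := by
  have h := R.measurePreserving_onSphere
  conv_rhs => rw [← h.map_eq]
  exact (integral_map (φ := R.onSphere) (f := fun ω => g ω) h.measurable.aemeasurable
    (hg.comp continuous_subtype_val).aestronglyMeasurable).symm

end Rotation

/-! ### Rotations of a coordinate plane and their generators. -/

section PlaneRotation

variable {E : Type*} [NormedAddCommGroup E] [InnerProductSpace ℝ E]

/-- The rotation by the angle `s` in the plane spanned by the orthonormal pair `e`, `f`. -/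
def planeRotation (e f : E) (s : ℝ) (x : E) : E :=
  x + ((Real.cos s - 1) * inner ℝ e x - Real.sin s * inner ℝ f x) • e +
    (Real.sin s * inner ℝ e x + (Real.cos s - 1) * inner ℝ f x) • f

theorem norm_planeRotation {e f : E} (he : ‖e‖ = 1) (hf : ‖f‖ = 1) (hef : inner ℝ e f = 0)
    (s : ℝ) (x : E) : ‖planeRotation e f s x‖ = ‖x‖ := by
  have hfe : inner ℝ f e = 0 := by rw [real_inner_comm, hef]
  rw [← sq_eq_sq₀ (norm_nonneg _) (norm_nonneg _), ← real_inner_self_eq_norm_sq,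
    ← real_inner_self_eq_norm_sq, planeRotation]
  simp only [inner_add_left, inner_add_right, inner_smul_left, inner_smul_right, hef, hfe,
    real_inner_self_eq_norm_sq e, real_inner_self_eq_norm_sq f, he, hf, real_inner_comm e x,
    real_inner_comm f x, map_add, map_sub, map_mul, conj_trivial]
  linear_combination ((inner ℝ e x) ^ 2 + (inner ℝ f x) ^ 2) * Real.sin_sq_add_cos_sq s

/-- `planeRotation` as a linear isometric equivalence. -/
def planeRotationEquiv [FiniteDimensional ℝ E] {e f : E} (he : ‖e‖ = 1) (hf : ‖f‖ = 1)
    (hef : inner ℝ e f = 0) (s : ℝ) : E ≃ₗᵢ[ℝ] E :=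
  LinearIsometry.toLinearIsometryEquiv
    { toFun := planeRotation e f s
      map_add' := fun x y => by
        simp only [planeRotation, inner_add_right]
        module
      map_smul' := fun c x => by
        simp only [planeRotation, inner_smul_right, RingHom.id_apply]
        module
      norm_map' := norm_planeRotation he hf hef s } rfl

theorem contDiff_planeRotation (e f : E) {r : WithTop ℕ∞} :
    ContDiff ℝ r fun p : ℝ × E => planeRotation e f p.1 p.2 := by
  unfold planeRotation
  have h1 : ContDiff ℝ r fun p : ℝ × E => inner ℝ e p.2 := contDiff_const.inner ℝ contDiff_snd
  have h2 : ContDiff ℝ r fun p : ℝ × E => inner ℝ f p.2 := contDiff_const.inner ℝ contDiff_snd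
  have h3 : ContDiff ℝ r fun p : ℝ × E => Real.cos p.1 := Real.contDiff_cos.comp contDiff_fst
  have h4 : ContDiff ℝ r fun p : ℝ × E => Real.sin p.1 := Real.contDiff_sin.comp contDiff_fst
  fun_prop

theorem hasDerivAt_planeRotation_zero (e f x : E) :
    HasDerivAt (fun s => planeRotation e f s x) (inner ℝ e x • f - inner ℝ f x • e) 0 := by
  have hc : HasDerivAt Real.cos 0 0 := by simpa using Real.hasDerivAt_cos 0
  have hs : HasDerivAt Real.sin 1 0 := by simpa using Real.hasDerivAt_sin 0
  have h1 := (((hc.sub_const 1).mul_const (inner ℝ e x)).sub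
    (hs.mul_const (inner ℝ f x))).smul_const e
  have h2 := ((hs.mul_const (inner ℝ e x)).add
    ((hc.sub_const 1).mul_const (inner ℝ f x))).smul_const f
  refine ((h1.const_add x).add h2).congr_deriv ?_
  module

theorem planeRotation_zero (e f x : E) : planeRotation e f 0 x = x := by
  simp [planeRotation]

/-- The generator of the rotations in the plane of `e` and `f`. -/
def rotationGenerator (e f : E) : E →L[ℝ] E :=
  (innerSL ℝ e).smulRight f - (innerSL ℝ f).smulRight e

theorem rotationGenerator_apply (e f x : E) :
    rotationGenerator e f x = inner ℝ e x • f - inner ℝ f x • e := rfl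

end PlaneRotation

/-! ### Integration by parts on the sphere along rotation fields. -/

section Divergence

variable {E : Type} [NormedAddCommGroup E] [InnerProductSpace ℝ E] [FiniteDimensional ℝ E]
  [MeasurableSpace E] [BorelSpace E]

/-- By invariance the integral of `g` composed with the rotation by angle `s` does not depend on
`s`; this is its derivative at `s = 0`. -/
theorem integral_fderiv_rotationGenerator {e f : E} (he : ‖e‖ = 1) (hf : ‖f‖ = 1)
    (hef : inner ℝ e f = 0) {g : E → ℝ} (hg : ContDiff ℝ 1 g) :
    ∫ ω : Metric.sphere (0 : E) 1, fderiv ℝ g ω (rotationGenerator e f ω)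
      ∂(volume : Measure E).toSphere = 0 := by
  have hF : ContDiff ℝ 1 fun p : ℝ × E => g (planeRotation e f p.1 p.2) :=
    hg.comp (contDiff_planeRotation e f)
  have h := dirDeriv_integral_sphere (μ := (volume : Measure E).toSphere) hF 1 0
  have hconst : (fun s : ℝ => ∫ ω : Metric.sphere (0 : E) 1, g (planeRotation e f s ω)
      ∂(volume : Measure E).toSphere) = fun _ => ∫ ω : Metric.sphere (0 : E) 1, g ω
      ∂(volume : Measure E).toSphere := by
    ext s
    exact (planeRotationEquiv he hf hef s).integral_comp_sphere hg.continuous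
  simp only [hconst] at h
  simp only [dirDeriv, fderiv_fun_const, Pi.zero_apply, _root_.zero_apply] at h
  rw [h]
  refine integral_congr_ae (Eventually.of_forall fun ω => ?_)
  have h1 : HasFDerivAt g (fderiv ℝ g ω) (planeRotation e f 0 ω) := by
    rw [planeRotation_zero]
    exact (hg.differentiable (by norm_num) _).hasFDerivAt
  have h2 := h1.comp_hasDerivAt 0 (hasDerivAt_planeRotation_zero e f ω)
  have h3 := h2.deriv
  rw [← fderiv_apply_one_eq_deriv] at h3
  exact h3.symm

/-- The previous lemma applied to `z ↦ Dg(x + t z)(J z)`; the product rule along `J z` yields the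
two terms. -/
theorem integral_second_fderiv_rotationGenerator {e f : E} (he : ‖e‖ = 1) (hf : ‖f‖ = 1)
    (hef : inner ℝ e f = 0) {g : E → ℝ} (hg : ContDiff ℝ 2 g) (x : E) (t : ℝ) :
    ∫ ω : Metric.sphere (0 : E) 1,
      (t * fderiv ℝ (fderiv ℝ g) (x + t • ω) (rotationGenerator e f ω) (rotationGenerator e f ω) +
        fderiv ℝ g (x + t • ω) (rotationGenerator e f (rotationGenerator e f ω)))
      ∂(volume : Measure E).toSphere = 0 := by
  set J := rotationGenerator e f
  have hg' : ContDiff ℝ 1 (fderiv ℝ g) := hg.fderiv_right (by norm_num)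
  have hG : ContDiff ℝ 1 fun z : E => fderiv ℝ g (x + t • z) (J z) :=
    (hg'.comp (by fun_prop)).clm_apply J.contDiff
  rw [← integral_fderiv_rotationGenerator he hf hef hG]
  refine integral_congr_ae (Eventually.of_forall fun ω => ?_)
  have h1 : HasFDerivAt (fun z : E => x + t • z) (t • ContinuousLinearMap.id ℝ E) (ω : E) :=
    ((hasFDerivAt_id (ω : E)).const_smul t).const_add x
  have h2 := (hg'.differentiable (by norm_num) (x + t • (ω : E))).hasFDerivAt.comp (ω : E) h1
  have h3 := h2.clm_apply (J.hasFDerivAt (x := (ω : E)))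
  have h4 := h3.fderiv
  simp only [Function.comp_def] at h4
  simp only [h4]
  simp [J]
  ring

end Divergence

/-! ### Darboux's equation. -/

section Darboux

variable {n : ℕ}

/-- The `i`-th standard unit vector. -/
def stdVec (i : Fin n) : EuclideanSpace ℝ (Fin n) := EuclideanSpace.single i 1

theorem inner_stdVec (i : Fin n) (x : EuclideanSpace ℝ (Fin n)) : inner ℝ (stdVec i) x = x i := by
  simp [stdVec, EuclideanSpace.inner_single_left]

theorem sum_smul_stdVec (x : EuclideanSpace ℝ (Fin n)) : ∑ i, x i • stdVec i = x := by
  have := (EuclideanSpace.basisFun (Fin n) ℝ).sum_repr x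
  simpa [stdVec] using this

/-- The second-order part of the spherical Laplacian: summing over ordered pairs counts each
coordinate plane twice, whence the factor `2`. Symmetry of `B` is not needed, since both orders of
the mixed terms sum to `B x x`. -/
theorem sum_second_fderiv_rotationGenerator
    (B : EuclideanSpace ℝ (Fin n) →L[ℝ] EuclideanSpace ℝ (Fin n) →L[ℝ] ℝ)
    (x : EuclideanSpace ℝ (Fin n)) :
    ∑ i, ∑ j, B (rotationGenerator (stdVec i) (stdVec j) x)
        (rotationGenerator (stdVec i) (stdVec j) x) =
      2 * (‖x‖ ^ 2 * ∑ i, B (stdVec i) (stdVec i) - B x x) := by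
  have hB : B x x = ∑ i, ∑ j, x i * x j * B (stdVec i) (stdVec j) := by
    conv_lhs => rw [← sum_smul_stdVec x]
    simp only [map_sum, _root_.sum_apply, map_smul, _root_.smul_apply,
      smul_eq_mul, Finset.mul_sum]
    rw [Finset.sum_comm]
    exact Finset.sum_congr rfl fun i _ => Finset.sum_congr rfl fun j _ => by ring
  have hB' : B x x = ∑ i, ∑ j, x i * x j * B (stdVec j) (stdVec i) := by
    rw [hB, Finset.sum_comm]
    exact Finset.sum_congr rfl fun i _ => Finset.sum_congr rfl fun j _ => by ring
  have h1 : ‖x‖ ^ 2 * ∑ i, B (stdVec i) (stdVec i) =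
      ∑ i, ∑ j, x i ^ 2 * B (stdVec j) (stdVec j) := by
    rw [EuclideanSpace.real_norm_sq_eq, Finset.sum_mul_sum]
  have h2 : ‖x‖ ^ 2 * ∑ i, B (stdVec i) (stdVec i) =
      ∑ i, ∑ j, x j ^ 2 * B (stdVec i) (stdVec i) := by
    rw [h1, Finset.sum_comm]
  calc _ = ∑ i, ∑ j, (x i ^ 2 * B (stdVec j) (stdVec j) + x j ^ 2 * B (stdVec i) (stdVec i) -
        x i * x j * B (stdVec i) (stdVec j) - x i * x j * B (stdVec j) (stdVec i)) := by
        refine Finset.sum_congr rfl fun i _ => Finset.sum_congr rfl fun j _ => ?_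
        simp only [rotationGenerator_apply, inner_stdVec, map_sub, map_smul,
          _root_.sub_apply, _root_.smul_apply, smul_eq_mul]
        ring
    _ = _ := by
        simp only [Finset.sum_sub_distrib, Finset.sum_add_distrib]
        rw [← h1, ← h2, ← hB, ← hB']
        ring

/-- For `i ≠ j` the square of the generator is minus the projection onto its plane, and each axis
lies in `n - 1` planes, each counted twice. -/
theorem sum_rotationGenerator_rotationGenerator (x : EuclideanSpace ℝ (Fin n)) :
    ∑ i, ∑ j, rotationGenerator (stdVec i) (stdVec j) (rotationGenerator (stdVec i) (stdVec j) x) =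
      (-2 * ((n : ℝ) - 1)) • x := by
  -- The conditional term makes the formula vanish on the diagonal, where the generator is zero.
  have h : ∀ i j, rotationGenerator (stdVec i) (stdVec j)
      (rotationGenerator (stdVec i) (stdVec j) x) =
        (if i = j then (2 * x i) • stdVec i else 0) - x i • stdVec i - x j • stdVec j := by
    intro i j
    by_cases hij : i = j
    · subst hij
      simp only [rotationGenerator_apply, sub_self, inner_zero_right, if_true]
      module
    · simp only [rotationGenerator_apply, inner_stdVec, if_neg hij]
      simp [stdVec, hij, Ne.symm hij]
      module
  simp only [h, Finset.sum_sub_distrib, Finset.sum_ite_eq, Finset.mem_univ, if_true, mul_smul,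
    Finset.sum_const, Finset.card_univ, Fintype.card_fin, sum_smul_stdVec, ← Finset.smul_sum]
  rw [← Nat.cast_smul_eq_nsmul ℝ]
  module

/-- The mean of `f` over the sphere of centre `p.1` and (possibly negative) radius `p.2`. -/
def centeredMean (f : EuclideanSpace ℝ (Fin n) → ℝ) (p : EuclideanSpace ℝ (Fin n) × ℝ) : ℝ :=
  (unitSphereArea n)⁻¹ * ∫ ω : Metric.sphere (0 : EuclideanSpace ℝ (Fin n)) 1,
    f (p.1 + p.2 • (ω : EuclideanSpace ℝ (Fin n)))
    ∂(volume : Measure (EuclideanSpace ℝ (Fin n))).toSphere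

theorem contDiff_centeredMean {r : ℕ} {f : EuclideanSpace ℝ (Fin n) → ℝ} (hf : ContDiff ℝ r f) :
    ContDiff ℝ r (centeredMean f) :=
  contDiff_const.mul (contDiff_integral_sphere r
    (F := fun q : (EuclideanSpace ℝ (Fin n) × ℝ) × EuclideanSpace ℝ (Fin n) =>
      f (q.1.1 + q.1.2 • q.2)) (hf.comp (by fun_prop)))

theorem fderiv_sphere_chart {g : EuclideanSpace ℝ (Fin n) → ℝ} (hg : Differentiable ℝ g)
    (ω v : EuclideanSpace ℝ (Fin n)) (τ : ℝ) (p : EuclideanSpace ℝ (Fin n) × ℝ) :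
    dirDeriv (v, τ) (fun q : EuclideanSpace ℝ (Fin n) × ℝ => g (q.1 + q.2 • ω)) p =
      fderiv ℝ g (p.1 + p.2 • ω) (v + τ • ω) := by
  have h1 : HasFDerivAt (fun q : EuclideanSpace ℝ (Fin n) × ℝ => q.1 + q.2 • ω)
      (ContinuousLinearMap.fst ℝ _ ℝ + (ContinuousLinearMap.snd ℝ _ ℝ).smulRight ω) p :=
    hasFDerivAt_fst.add (hasFDerivAt_snd.smul_const ω)
  have h2 := ((hg _).hasFDerivAt.comp p h1).fderiv
  simp only [Function.comp_def] at h2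
  simp [dirDeriv, h2]

theorem dirDeriv_centeredMean {f : EuclideanSpace ℝ (Fin n) → ℝ} (hf : ContDiff ℝ 1 f)
    (v : EuclideanSpace ℝ (Fin n)) (τ : ℝ) (p : EuclideanSpace ℝ (Fin n) × ℝ) :
    dirDeriv (v, τ) (centeredMean f) p =
      (unitSphereArea n)⁻¹ * ∫ ω : Metric.sphere (0 : EuclideanSpace ℝ (Fin n)) 1,
        fderiv ℝ f (p.1 + p.2 • (ω : EuclideanSpace ℝ (Fin n))) (v + τ • ω)
        ∂(volume : Measure (EuclideanSpace ℝ (Fin n))).toSphere := by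
  have hF : ContDiff ℝ 1 fun q : (EuclideanSpace ℝ (Fin n) × ℝ) × EuclideanSpace ℝ (Fin n) =>
      f (q.1.1 + q.1.2 • q.2) := hf.comp (by fun_prop)
  have hd := (contDiff_integral_sphere
    (μ := (volume : Measure (EuclideanSpace ℝ (Fin n))).toSphere) 1 hF).differentiable (by norm_num)
  have h := dirDeriv_integral_sphere
    (μ := (volume : Measure (EuclideanSpace ℝ (Fin n))).toSphere) hF (v, τ) p
  unfold centeredMean
  dsimp only at hd h
  rw [dirDeriv_const_mul hd]
  beta_reduce
  rw [h]
  simp only [fderiv_sphere_chart (hf.differentiable (by norm_num))]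

theorem dirDeriv_dirDeriv_centeredMean {f : EuclideanSpace ℝ (Fin n) → ℝ} (hf : ContDiff ℝ 2 f)
    (v : EuclideanSpace ℝ (Fin n)) (τ : ℝ) (p : EuclideanSpace ℝ (Fin n) × ℝ) :
    dirDeriv (v, τ) (dirDeriv (v, τ) (centeredMean f)) p =
      (unitSphereArea n)⁻¹ * ∫ ω : Metric.sphere (0 : EuclideanSpace ℝ (Fin n)) 1,
        fderiv ℝ (fderiv ℝ f) (p.1 + p.2 • (ω : EuclideanSpace ℝ (Fin n))) (v + τ • ω) (v + τ • ω)
        ∂(volume : Measure (EuclideanSpace ℝ (Fin n))).toSphere := by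
  have hf' : ContDiff ℝ 1 (fderiv ℝ f) := hf.fderiv_right (by norm_num)
  have hF : ContDiff ℝ 1 fun q : (EuclideanSpace ℝ (Fin n) × ℝ) × EuclideanSpace ℝ (Fin n) =>
      fderiv ℝ f (q.1.1 + q.1.2 • q.2) (v + τ • q.2) :=
    (hf'.comp (by fun_prop)).clm_apply (by fun_prop)
  have hd := (contDiff_integral_sphere
    (μ := (volume : Measure (EuclideanSpace ℝ (Fin n))).toSphere) 1 hF).differentiable (by norm_num)
  have h := dirDeriv_integral_sphere
    (μ := (volume : Measure (EuclideanSpace ℝ (Fin n))).toSphere) hF (v, τ) p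
  dsimp only at hd h
  rw [funext (dirDeriv_centeredMean (hf.of_le (by norm_num)) v τ), dirDeriv_const_mul hd]
  beta_reduce
  rw [h]
  congr 1
  refine integral_congr_ae (Eventually.of_forall fun ω => ?_)
  have hg : Differentiable ℝ fun y => fderiv ℝ f y (v + τ • (ω : EuclideanSpace ℝ (Fin n))) :=
    fun y => (hf'.differentiable (by norm_num) y).clm_apply (differentiableAt_const _)
  simp only [fderiv_sphere_chart hg]
  rw [fderiv_clm_apply (hf'.differentiable (by norm_num) _) (differentiableAt_const _)]
  simp
  ring

/-- The Laplacian in the space variables. -/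
def spaceLaplacian (h : EuclideanSpace ℝ (Fin n) × ℝ → ℝ) (p : EuclideanSpace ℝ (Fin n) × ℝ) : ℝ :=
  ∑ i, dirDeriv (stdVec i, 0) (dirDeriv (stdVec i, 0) h) p

/-- The derivative in the time variable. -/
def timeDeriv (h : EuclideanSpace ℝ (Fin n) × ℝ → ℝ) : EuclideanSpace ℝ (Fin n) × ℝ → ℝ :=
  dirDeriv (0, 1) h

/-- Darboux's equation for spherical means. -/
theorem darboux_centeredMean {f : EuclideanSpace ℝ (Fin n) → ℝ} (hf : ContDiff ℝ 2 f)
    (p : EuclideanSpace ℝ (Fin n) × ℝ) :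
    p.2 * timeDeriv (timeDeriv (centeredMean f)) p + ((n : ℝ) - 1) * timeDeriv (centeredMean f) p =
      p.2 * spaceLaplacian (centeredMean f) p := by
  obtain ⟨x, t⟩ := p
  have hc1 : Continuous (fderiv ℝ f) := hf.continuous_fderiv (by norm_num)
  have hc2 : Continuous (fderiv ℝ (fderiv ℝ f)) :=
    (hf.fderiv_right (m := 1) (by norm_num)).continuous_fderiv (by norm_num)
  have hy : Continuous fun ω : Metric.sphere (0 : EuclideanSpace ℝ (Fin n)) 1 =>
    x + t • (ω : EuclideanSpace ℝ (Fin n)) := by fun_prop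
  have hω := continuous_subtype_val (p := fun x => x ∈ Metric.sphere (0 : EuclideanSpace ℝ (Fin n)) 1)
  have hI1 : ∀ {v : Metric.sphere (0 : EuclideanSpace ℝ (Fin n)) 1 → EuclideanSpace ℝ (Fin n)},
      Continuous v → Integrable (fun ω : Metric.sphere (0 : EuclideanSpace ℝ (Fin n)) 1 =>
        fderiv ℝ f (x + t • (ω : EuclideanSpace ℝ (Fin n))) (v ω))
        (volume : Measure (EuclideanSpace ℝ (Fin n))).toSphere := fun hv =>
    ((hc1.comp hy).clm_apply hv).integrable_of_compactSpace
  have hI2 : ∀ {v : Metric.sphere (0 : EuclideanSpace ℝ (Fin n)) 1 → EuclideanSpace ℝ (Fin n)},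
      Continuous v → Integrable (fun ω : Metric.sphere (0 : EuclideanSpace ℝ (Fin n)) 1 =>
        fderiv ℝ (fderiv ℝ f) (x + t • (ω : EuclideanSpace ℝ (Fin n)))
        (v ω) (v ω))
        (volume : Measure (EuclideanSpace ℝ (Fin n))).toSphere := fun hv =>
    (((hc2.comp hy).clm_apply hv).clm_apply hv).integrable_of_compactSpace
  have hJ : ∀ i j : Fin n, ∫ ω : Metric.sphere (0 : EuclideanSpace ℝ (Fin n)) 1,
      (t * fderiv ℝ (fderiv ℝ f) (x + t • (ω : EuclideanSpace ℝ (Fin n)))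
          (rotationGenerator (stdVec i) (stdVec j) ω) (rotationGenerator (stdVec i) (stdVec j) ω) +
        fderiv ℝ f (x + t • (ω : EuclideanSpace ℝ (Fin n))) (rotationGenerator (stdVec i) (stdVec j)
          (rotationGenerator (stdVec i) (stdVec j) ω)))
      ∂(volume : Measure (EuclideanSpace ℝ (Fin n))).toSphere = 0 := by
    intro i j
    by_cases hij : i = j
    · subst hij
      simp [rotationGenerator_apply]
    · refine integral_second_fderiv_rotationGenerator ?_ ?_ ?_ hf x t
      · simp [stdVec]
      · simp [stdVec]
      · rw [inner_stdVec]
        simp [stdVec, hij]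
  have hsum := Finset.sum_eq_zero fun i (_ : i ∈ Finset.univ) =>
    Finset.sum_eq_zero fun j (_ : j ∈ Finset.univ) => hJ i j
  have hint : ∀ i j : Fin n, Integrable (fun ω : Metric.sphere (0 : EuclideanSpace ℝ (Fin n)) 1 =>
      t * fderiv ℝ (fderiv ℝ f) (x + t • (ω : EuclideanSpace ℝ (Fin n)))
          (rotationGenerator (stdVec i) (stdVec j) ω) (rotationGenerator (stdVec i) (stdVec j) ω) +
        fderiv ℝ f (x + t • (ω : EuclideanSpace ℝ (Fin n))) (rotationGenerator (stdVec i) (stdVec j)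
          (rotationGenerator (stdVec i) (stdVec j) ω)))
      (volume : Measure (EuclideanSpace ℝ (Fin n))).toSphere := fun i j =>
    ((hI2 (by fun_prop)).const_mul t).add (hI1 (by fun_prop))
  simp only [← integral_finsetSum Finset.univ fun j _ => hint _ j] at hsum
  rw [← integral_finsetSum Finset.univ fun i _ => integrable_finsetSum _ fun j _ => hint i j]
    at hsum
  -- On the unit sphere `‖ω‖ = 1`, so the two algebraic sums turn the integrand into twice the terms
  -- of Darboux's equation.
  have hpt : ∀ ω : Metric.sphere (0 : EuclideanSpace ℝ (Fin n)) 1, ∑ i, ∑ j,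
      (t * fderiv ℝ (fderiv ℝ f) (x + t • (ω : EuclideanSpace ℝ (Fin n)))
          (rotationGenerator (stdVec i) (stdVec j) ω) (rotationGenerator (stdVec i) (stdVec j) ω) +
        fderiv ℝ f (x + t • (ω : EuclideanSpace ℝ (Fin n))) (rotationGenerator (stdVec i) (stdVec j)
          (rotationGenerator (stdVec i) (stdVec j) ω))) =
      2 * (t * (∑ i, fderiv ℝ (fderiv ℝ f) (x + t • (ω : EuclideanSpace ℝ (Fin n)))
          (stdVec i) (stdVec i))) -
        2 * (t * fderiv ℝ (fderiv ℝ f) (x + t • (ω : EuclideanSpace ℝ (Fin n))) ω ω) -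
        2 * (((n : ℝ) - 1) * fderiv ℝ f (x + t • (ω : EuclideanSpace ℝ (Fin n))) ω) := by
    intro ω
    have h1 := sum_second_fderiv_rotationGenerator
      (fderiv ℝ (fderiv ℝ f) (x + t • (ω : EuclideanSpace ℝ (Fin n)))) (ω : EuclideanSpace ℝ (Fin n))
    have h2 := congrArg (fderiv ℝ f (x + t • (ω : EuclideanSpace ℝ (Fin n))))
      (sum_rotationGenerator_rotationGenerator (ω : EuclideanSpace ℝ (Fin n)))
    have h0 : ‖(ω : EuclideanSpace ℝ (Fin n))‖ = 1 := by simp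
    rw [h0] at h1
    simp only [map_sum, map_smul, smul_eq_mul] at h2
    simp only [Finset.sum_add_distrib, ← Finset.mul_sum]
    rw [h1, h2]
    ring
  have hIs : Integrable (fun ω : Metric.sphere (0 : EuclideanSpace ℝ (Fin n)) 1 =>
      ∑ i, fderiv ℝ (fderiv ℝ f) (x + t • (ω : EuclideanSpace ℝ (Fin n))) (stdVec i) (stdVec i))
      (volume : Measure (EuclideanSpace ℝ (Fin n))).toSphere :=
    integrable_finsetSum _ fun i _ => hI2 continuous_const
  simp only [hpt] at hsum
  rw [integral_sub, integral_sub] at hsum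
  rotate_left
  · exact (hIs.const_mul t).const_mul 2
  · exact ((hI2 hω).const_mul t).const_mul 2
  · exact ((hIs.const_mul t).const_mul 2).sub (((hI2 hω).const_mul t).const_mul 2)
  · exact ((hI1 hω).const_mul _).const_mul 2
  simp only [integral_const_mul] at hsum
  rw [integral_finsetSum _ fun i _ => hI2 continuous_const] at hsum
  simp only [spaceLaplacian, timeDeriv, dirDeriv_dirDeriv_centeredMean hf,
    dirDeriv_centeredMean (hf.of_le (by norm_num)), zero_add, one_smul, zero_smul, add_zero,
    ← Finset.mul_sum]
  linear_combination (-(unitSphereArea n)⁻¹ / 2) * hsum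

end Darboux

/-! ### The Euler–Poisson–Darboux equation, its parameter shift, and the wave equation. -/

section EulerPoissonDarboux

variable {n : ℕ}

theorem dirDeriv_snd_mul {h : EuclideanSpace ℝ (Fin n) × ℝ → ℝ} (hh : Differentiable ℝ h)
    (v : EuclideanSpace ℝ (Fin n)) (τ : ℝ) :
    dirDeriv (v, τ) (fun p => p.2 * h p) = fun p => p.2 * dirDeriv (v, τ) h p + τ * h p := by
  rw [dirDeriv_mul differentiable_snd hh]
  ext p
  simp [dirDeriv, fderiv_snd, mul_comm]

theorem ContDiff.timeDeriv {r s : ℕ} {h : EuclideanSpace ℝ (Fin n) × ℝ → ℝ}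
    (hh : ContDiff ℝ s h) (hrs : r + 1 ≤ s) : ContDiff ℝ r (timeDeriv h) :=
  hh.dirDeriv hrs _

theorem timeDeriv_snd_mul {h : EuclideanSpace ℝ (Fin n) × ℝ → ℝ} (hh : Differentiable ℝ h) :
    timeDeriv (fun p => p.2 * h p) = fun p => p.2 * timeDeriv h p + h p := by
  simp only [timeDeriv, dirDeriv_snd_mul hh, one_mul]

theorem spaceLaplacian_snd_mul {h : EuclideanSpace ℝ (Fin n) × ℝ → ℝ} (hh : ContDiff ℝ 2 h) :
    spaceLaplacian (fun p => p.2 * h p) = fun p => p.2 * spaceLaplacian h p := by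
  ext p
  have h1 : ∀ i, Differentiable ℝ (dirDeriv (stdVec i, (0 : ℝ)) h) := fun i =>
    (hh.dirDeriv (r := 1) (s := 2) le_rfl _).differentiable (by norm_num)
  simp only [spaceLaplacian, dirDeriv_snd_mul (hh.differentiable (by norm_num)), zero_mul,
    add_zero, dirDeriv_snd_mul (h1 _), Finset.mul_sum]

theorem spaceLaplacian_const_mul {h : EuclideanSpace ℝ (Fin n) × ℝ → ℝ} (hh : ContDiff ℝ 2 h)
    (c : ℝ) : spaceLaplacian (fun p => c * h p) = fun p => c * spaceLaplacian h p := by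
  ext p
  have h1 : ∀ i, Differentiable ℝ (dirDeriv (stdVec i, (0 : ℝ)) h) := fun i =>
    (hh.dirDeriv (r := 1) (s := 2) le_rfl _).differentiable (by norm_num)
  simp only [spaceLaplacian, dirDeriv_const_mul (hh.differentiable (by norm_num)),
    dirDeriv_const_mul (h1 _), Finset.mul_sum]

theorem spaceLaplacian_add {h₁ h₂ : EuclideanSpace ℝ (Fin n) × ℝ → ℝ} (hh₁ : ContDiff ℝ 2 h₁)
    (hh₂ : ContDiff ℝ 2 h₂) :
    spaceLaplacian (fun p => h₁ p + h₂ p) = fun p => spaceLaplacian h₁ p + spaceLaplacian h₂ p := by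
  ext p
  have h1 : ∀ {h : EuclideanSpace ℝ (Fin n) × ℝ → ℝ}, ContDiff ℝ 2 h → ∀ i,
      Differentiable ℝ (dirDeriv (stdVec i, (0 : ℝ)) h) := fun hh i =>
    (hh.dirDeriv (r := 1) (s := 2) le_rfl _).differentiable (by norm_num)
  simp only [spaceLaplacian, dirDeriv_add (hh₁.differentiable (by norm_num))
    (hh₂.differentiable (by norm_num)), dirDeriv_add (h1 hh₁ _) (h1 hh₂ _), Finset.sum_add_distrib]

theorem ContDiff.differentiable_spaceLaplacian {h : EuclideanSpace ℝ (Fin n) × ℝ → ℝ}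
    (hh : ContDiff ℝ 3 h) : Differentiable ℝ (spaceLaplacian h) :=
  Differentiable.fun_sum fun i _ => ((hh.dirDeriv (r := 2) (s := 3) le_rfl _).dirDeriv
    (r := 1) (s := 2) le_rfl (stdVec i, (0 : ℝ))).differentiable (by norm_num)

theorem timeDeriv_spaceLaplacian {h : EuclideanSpace ℝ (Fin n) × ℝ → ℝ} (hh : ContDiff ℝ 3 h) :
    timeDeriv (spaceLaplacian h) = spaceLaplacian (timeDeriv h) := by
  have h2 : ∀ i, ContDiff ℝ 2 (dirDeriv (stdVec i, (0 : ℝ)) h) := fun i =>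
    hh.dirDeriv (r := 2) (s := 3) le_rfl _
  have h1 : ∀ i, Differentiable ℝ (dirDeriv (stdVec i, (0 : ℝ)) (dirDeriv (stdVec i, (0 : ℝ)) h)) :=
    fun i => ((h2 i).dirDeriv (r := 1) (s := 2) le_rfl _).differentiable (by norm_num)
  unfold spaceLaplacian timeDeriv
  rw [dirDeriv_sum _ h1]
  ext p
  refine Finset.sum_congr rfl fun i _ => ?_
  rw [dirDeriv_comm (h2 i), dirDeriv_comm (hh.of_le (by norm_num))]

/-- The Euler–Poisson–Darboux equation `w_tt + (a / t) w_t = ∇² w`, cleared of its denominator. -/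
def SolvesEPD (a : ℝ) (w : EuclideanSpace ℝ (Fin n) × ℝ → ℝ) : Prop :=
  ∀ p, p.2 * timeDeriv (timeDeriv w) p + a * timeDeriv w p = p.2 * spaceLaplacian w p

/-- The operator `w ↦ b w + t w_t`. -/
def radialShift (b : ℝ) (w : EuclideanSpace ℝ (Fin n) × ℝ → ℝ) :
    EuclideanSpace ℝ (Fin n) × ℝ → ℝ := fun p => b * w p + p.2 * timeDeriv w p

theorem ContDiff.radialShift {r : ℕ} {w : EuclideanSpace ℝ (Fin n) × ℝ → ℝ}
    (hw : ContDiff ℝ (r + 1 : ℕ) w) (b : ℝ) : ContDiff ℝ r (radialShift b w) :=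
  (contDiff_const.mul (hw.of_le (by exact_mod_cast Nat.le_succ r))).add
    (contDiff_snd.mul (hw.timeDeriv le_rfl))

/-- The shifted function `v` satisfies `v_t = a w_t + t w_tt = t ∇² w` by the equation for `w`.
Hence `t v_tt + (a - 2) v_t = t ((a - 1) ∇² w + t ∇² w_t) = t ∇² v`; commuting `∂_t` with `∇²` uses
the third derivatives. -/
theorem SolvesEPD.radialShift {a : ℝ} {w : EuclideanSpace ℝ (Fin n) × ℝ → ℝ}
    (h : SolvesEPD a w) (hw : ContDiff ℝ 3 w) : SolvesEPD (a - 2) (radialShift (a - 1) w) := by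
  have hw2 : ContDiff ℝ 2 w := hw.of_le (by norm_num)
  have hwt : ContDiff ℝ 2 (timeDeriv w) := hw.timeDeriv (r := 2) (s := 3) le_rfl
  have hd : Differentiable ℝ w := hw.differentiable (by norm_num)
  have hdt : Differentiable ℝ (timeDeriv w) := hwt.differentiable (by norm_num)
  have h1 : timeDeriv (_root_.radialShift (a - 1) w) = fun p => p.2 * spaceLaplacian w p := by
    unfold _root_.radialShift
    rw [timeDeriv, dirDeriv_add (hd.const_mul _) (differentiable_snd.fun_mul hdt),
      dirDeriv_const_mul hd]
    change (fun p => (a - 1) * timeDeriv w p + timeDeriv (fun p => p.2 * timeDeriv w p) p) = _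
    rw [timeDeriv_snd_mul hdt]
    ext p
    linear_combination h p
  have h2 : spaceLaplacian (_root_.radialShift (a - 1) w) =
      fun p => (a - 1) * spaceLaplacian w p + p.2 * timeDeriv (spaceLaplacian w) p := by
    unfold _root_.radialShift
    rw [spaceLaplacian_add (contDiff_const.mul hw2) (contDiff_snd.mul hwt),
      spaceLaplacian_const_mul hw2, spaceLaplacian_snd_mul hwt, timeDeriv_spaceLaplacian hw]
  intro p
  rw [h1, h2, timeDeriv_snd_mul hw.differentiable_spaceLaplacian]
  ring

/-- `(t w)_tt = t w_tt + 2 w_t`, which is the left side of the equation with parameter `2`. -/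
theorem SolvesEPD.wave {w : EuclideanSpace ℝ (Fin n) × ℝ → ℝ} (h : SolvesEPD 2 w)
    (hw : ContDiff ℝ 2 w) :
    timeDeriv (timeDeriv fun p => p.2 * w p) = fun p => p.2 * spaceLaplacian w p := by
  have hd : Differentiable ℝ w := hw.differentiable (by norm_num)
  have hdt : Differentiable ℝ (timeDeriv w) :=
    (hw.timeDeriv (r := 1) (s := 2) le_rfl).differentiable (by norm_num)
  rw [timeDeriv_snd_mul hd, timeDeriv, dirDeriv_add (differentiable_snd.fun_mul hdt) hd]
  change (fun p => timeDeriv (fun p => p.2 * timeDeriv w p) p + timeDeriv w p) = _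
  rw [timeDeriv_snd_mul hdt]
  ext p
  linear_combination h p

/-- The spherical mean after `i` applications of `t⁻¹ ∂_t` to `t ^ (n - 2)` times it, divided by
`t ^ (n - 2 - 2 i)`. -/
def shiftedMean (f : EuclideanSpace ℝ (Fin n) → ℝ) : ℕ → EuclideanSpace ℝ (Fin n) × ℝ → ℝ
  | 0 => centeredMean f
  | i + 1 => radialShift ((n : ℝ) - 2 - 2 * i) (shiftedMean f i)

/-- Each shift costs one derivative, so `r` varies in the induction. -/
theorem contDiff_shiftedMean {f : EuclideanSpace ℝ (Fin n) → ℝ} (i : ℕ) :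
    ∀ {r : ℕ}, ContDiff ℝ (i + r : ℕ) f → ContDiff ℝ r (shiftedMean f i) := by
  induction i with
  | zero => intro r hf; exact contDiff_centeredMean (by simpa using hf)
  | succ i ih =>
    intro r hf
    exact (ih (r := r + 1) (by rwa [add_right_comm, add_assoc] at hf)).radialShift _

theorem solvesEPD_shiftedMean {f : EuclideanSpace ℝ (Fin n) → ℝ} (i : ℕ)
    (hf : ContDiff ℝ (i + 2 : ℕ) f) : SolvesEPD ((n : ℝ) - 1 - 2 * i) (shiftedMean f i) := by
  induction i with
  | zero => simpa [SolvesEPD, shiftedMean] using fun a b => darboux_centeredMean hf (a, b)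
  | succ i ih =>
    have h := (ih (hf.of_le (by exact_mod_cast (by lia)))).radialShift
      (contDiff_shiftedMean (r := 3) i (by rwa [add_assoc, add_comm 1 2] at hf))
    have h1 : (n : ℝ) - 1 - 2 * (i + 1 : ℕ) = (n : ℝ) - 1 - 2 * i - 2 := by push_cast; ring
    have h2 : (n : ℝ) - 2 - 2 * i = (n : ℝ) - 1 - 2 * i - 1 := by ring
    rw [shiftedMean, h1, h2]
    exact h

theorem unitSphereArea_ne_zero (hn : n ≠ 0) : unitSphereArea n ≠ 0 := by
  rw [unitSphereArea, Measure.toSphere_real_apply_univ, finrank_euclideanSpace_fin]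
  exact mul_ne_zero (by exact_mod_cast hn)
    (ENNReal.toReal_pos (Metric.measure_ball_pos _ _ one_pos).ne' measure_ball_lt_top.ne).ne'

theorem centeredMean_zero (hn : n ≠ 0) (f : EuclideanSpace ℝ (Fin n) → ℝ)
    (x : EuclideanSpace ℝ (Fin n)) : centeredMean f (x, 0) = f x := by
  simp only [centeredMean, zero_smul, add_zero, integral_const, smul_eq_mul]
  exact inv_mul_cancel_left₀ (unitSphereArea_ne_zero hn) _

/-- At `t = 0` the term `t w_t` drops out, so a shift only multiplies by its coefficient. -/
theorem shiftedMean_zero (hn : n ≠ 0) (f : EuclideanSpace ℝ (Fin n) → ℝ)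
    (x : EuclideanSpace ℝ (Fin n)) (i : ℕ) :
    shiftedMean f i (x, 0) = (∏ j ∈ Finset.range i, ((n : ℝ) - 2 - 2 * j)) * f x := by
  induction i with
  | zero => simp [shiftedMean, centeredMean_zero hn]
  | succ i ih =>
    simp only [shiftedMean, radialShift, ih, Finset.prod_range_succ]
    ring

theorem waveConst_mul_prod (hn : Odd n) (hn3 : 3 ≤ n) :
    waveConst n * ∏ j ∈ Finset.range ((n - 3) / 2), ((n : ℝ) - 2 - 2 * j) = 1 := by
  obtain ⟨k, rfl⟩ := hn
  obtain ⟨m, rfl⟩ : ∃ m, k = m + 1 := ⟨k - 1, by lia⟩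
  have h1 : (2 * (m + 1) + 1 - 3) / 2 = m := by lia
  have h2 : 2 * (m + 1) + 1 - 2 = 2 * m + 1 := by lia
  -- The product runs from `n - 2` down to `3`; the factor `1` of the double factorial is absent.
  have h3 : ∏ j ∈ Finset.range m, (((2 * (m + 1) + 1 : ℕ) : ℝ) - 2 - 2 * j) =
      ((2 * m + 1).doubleFactorial : ℝ) := by
    rw [Nat.doubleFactorial_eq_prod_odd, ← Finset.prod_range_reflect, Nat.cast_prod]
    refine Finset.prod_congr rfl fun j hj => ?_
    have : j + 1 ≤ m := Finset.mem_range.1 hj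
    rw [Nat.sub_sub, add_comm 1 j]
    push_cast [Nat.cast_sub this]
    ring
  rw [h1, h3, waveConst, h2]
  exact inv_mul_cancel₀ (by exact_mod_cast (Nat.doubleFactorial_pos _).ne')

/-- The function `c_n ((1/t) ∂_t)^{(n-3)/2} (t^{n-2} M_t f (x))`, continued to all real `t`. -/
def wavePotential (f : EuclideanSpace ℝ (Fin n) → ℝ) (p : EuclideanSpace ℝ (Fin n) × ℝ) : ℝ :=
  waveConst n * (p.2 * shiftedMean f ((n - 3) / 2) p)

theorem contDiff_wavePotential {f : EuclideanSpace ℝ (Fin n) → ℝ} {r : ℕ}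
    (hf : ContDiff ℝ ((n - 3) / 2 + r : ℕ) f) : ContDiff ℝ r (wavePotential f) :=
  contDiff_const.mul (contDiff_snd.mul (contDiff_shiftedMean _ hf))

theorem wavePotential_zero (f : EuclideanSpace ℝ (Fin n) → ℝ) (x : EuclideanSpace ℝ (Fin n)) :
    wavePotential f (x, 0) = 0 := by
  simp [wavePotential]

theorem timeDeriv_wavePotential {f : EuclideanSpace ℝ (Fin n) → ℝ}
    (hf : ContDiff ℝ ((n - 3) / 2 + 1 : ℕ) f) :
    timeDeriv (wavePotential f) = fun p => waveConst n *
      (p.2 * timeDeriv (shiftedMean f ((n - 3) / 2)) p + shiftedMean f ((n - 3) / 2) p) := by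
  have hd : Differentiable ℝ (shiftedMean f ((n - 3) / 2)) :=
    (contDiff_shiftedMean (r := 1) _ hf).differentiable (by norm_num)
  have h := dirDeriv_const_mul (differentiable_snd.fun_mul hd) (waveConst n)
    ((0, 1) : EuclideanSpace ℝ (Fin n) × ℝ)
  change timeDeriv (wavePotential f) = fun p => _ * timeDeriv _ p at h
  rwa [timeDeriv_snd_mul hd] at h

theorem timeDeriv_wavePotential_zero (hn : Odd n) (hn3 : 3 ≤ n) {f : EuclideanSpace ℝ (Fin n) → ℝ}
    (hf : ContDiff ℝ ((n - 3) / 2 + 1 : ℕ) f) (x : EuclideanSpace ℝ (Fin n)) :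
    timeDeriv (wavePotential f) (x, 0) = f x := by
  rw [timeDeriv_wavePotential hf]
  simp only [zero_mul, zero_add, shiftedMean_zero (by lia : n ≠ 0)]
  rw [← mul_assoc, waveConst_mul_prod hn hn3, one_mul]

theorem timeDeriv_timeDeriv_wavePotential (hn : Odd n) (hn3 : 3 ≤ n)
    {f : EuclideanSpace ℝ (Fin n) → ℝ} (hf : ContDiff ℝ ((n - 3) / 2 + 2 : ℕ) f) :
    timeDeriv (timeDeriv (wavePotential f)) =
      fun p => waveConst n * (p.2 * spaceLaplacian (shiftedMean f ((n - 3) / 2)) p) := by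
  have hw : ContDiff ℝ 2 (shiftedMean f ((n - 3) / 2)) := contDiff_shiftedMean (r := 2) _ hf
  have hE := solvesEPD_shiftedMean _ hf
  obtain ⟨k, rfl⟩ := hn
  -- Oddness of `n` makes the final parameter exactly `2`.
  have h2 : ((2 * k + 1 : ℕ) : ℝ) - 1 - 2 * ((2 * k + 1 - 3) / 2 : ℕ) = 2 := by
    obtain ⟨m, rfl⟩ : ∃ m, k = m + 1 := ⟨k - 1, by lia⟩
    rw [show (2 * (m + 1) + 1 - 3) / 2 = m by lia]
    push_cast; ring
  rw [h2] at hE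
  have hp : ContDiff ℝ 2 fun p : EuclideanSpace ℝ (Fin (2 * k + 1)) × ℝ =>
    p.2 * shiftedMean f ((2 * k + 1 - 3) / 2) p := contDiff_snd.mul hw
  have h1 : timeDeriv (wavePotential f) = fun p => waveConst (2 * k + 1) *
      timeDeriv (fun p => p.2 * shiftedMean f ((2 * k + 1 - 3) / 2) p) p :=
    dirDeriv_const_mul (hp.differentiable (by norm_num)) _ _
  have h3 := dirDeriv_const_mul ((hp.timeDeriv (r := 1) (s := 2) le_rfl).differentiable
    (by norm_num)) (waveConst (2 * k + 1)) ((0, 1) : EuclideanSpace ℝ (Fin (2 * k + 1)) × ℝ)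
  rw [← h1] at h3
  change timeDeriv (timeDeriv (wavePotential f)) = fun p => _ * timeDeriv (timeDeriv _) p at h3
  rwa [hE.wave hw] at h3

theorem wavePotential_wave (hn : Odd n) (hn3 : 3 ≤ n) {f : EuclideanSpace ℝ (Fin n) → ℝ}
    (hf : ContDiff ℝ ((n - 3) / 2 + 2 : ℕ) f) :
    timeDeriv (timeDeriv (wavePotential f)) = spaceLaplacian (wavePotential f) := by
  have hw : ContDiff ℝ 2 (shiftedMean f ((n - 3) / 2)) := contDiff_shiftedMean (r := 2) _ hf
  rw [timeDeriv_timeDeriv_wavePotential hn hn3 hf]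
  unfold wavePotential
  rw [spaceLaplacian_const_mul (contDiff_snd.mul hw), spaceLaplacian_snd_mul hw]

/-- The solution of the wave equation, continued to all real `t`. -/
def extendedSolution (φ ψ : EuclideanSpace ℝ (Fin n) → ℝ) (p : EuclideanSpace ℝ (Fin n) × ℝ) : ℝ :=
  timeDeriv (wavePotential φ) p + wavePotential ψ p

theorem contDiff_extendedSolution {φ ψ : EuclideanSpace ℝ (Fin n) → ℝ}
    (hφ : ContDiff ℝ ((n - 3) / 2 + 3 : ℕ) φ) (hψ : ContDiff ℝ ((n - 3) / 2 + 2 : ℕ) ψ) :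
    ContDiff ℝ 2 (extendedSolution φ ψ) :=
  ((contDiff_wavePotential hφ).timeDeriv (r := 2) le_rfl).add (contDiff_wavePotential (r := 2) hψ)

theorem timeDeriv_extendedSolution {φ ψ : EuclideanSpace ℝ (Fin n) → ℝ}
    (hφ : ContDiff ℝ ((n - 3) / 2 + 3 : ℕ) φ) (hψ : ContDiff ℝ ((n - 3) / 2 + 2 : ℕ) ψ) :
    timeDeriv (extendedSolution φ ψ) =
      fun p => timeDeriv (timeDeriv (wavePotential φ)) p + timeDeriv (wavePotential ψ) p :=
  dirDeriv_add
    (((contDiff_wavePotential hφ).timeDeriv (r := 2) le_rfl).differentiable (by norm_num))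
    ((contDiff_wavePotential (r := 2) hψ).differentiable (by norm_num)) _

/-- The time derivative of a `C³` wave is again a wave, because `∂_t` commutes with `∇²`. -/
theorem extendedSolution_wave (hn : Odd n) (hn3 : 3 ≤ n) {φ ψ : EuclideanSpace ℝ (Fin n) → ℝ}
    (hφ : ContDiff ℝ ((n - 3) / 2 + 3 : ℕ) φ) (hψ : ContDiff ℝ ((n - 3) / 2 + 2 : ℕ) ψ) :
    timeDeriv (timeDeriv (extendedSolution φ ψ)) = spaceLaplacian (extendedSolution φ ψ) := by
  have hK : ContDiff ℝ 3 (wavePotential φ) := contDiff_wavePotential (r := 3) hφ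
  have hK' : ContDiff ℝ 2 (timeDeriv (wavePotential φ)) := hK.timeDeriv (r := 2) (s := 3) le_rfl
  have hL : ContDiff ℝ 2 (wavePotential ψ) := contDiff_wavePotential (r := 2) hψ
  rw [timeDeriv_extendedSolution hφ hψ, timeDeriv, dirDeriv_add
    ((hK'.timeDeriv (r := 1) (s := 2) le_rfl).differentiable (by norm_num))
    ((hL.timeDeriv (r := 1) (s := 2) le_rfl).differentiable (by norm_num))]
  change (fun p => timeDeriv (timeDeriv (timeDeriv (wavePotential φ))) p +
    timeDeriv (timeDeriv (wavePotential ψ)) p) = _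
  rw [wavePotential_wave hn hn3 (hφ.of_le (by exact_mod_cast (by lia))),
    wavePotential_wave hn hn3 hψ, timeDeriv_spaceLaplacian hK]
  exact (spaceLaplacian_add hK' hL).symm

theorem extendedSolution_zero (hn : Odd n) (hn3 : 3 ≤ n) {φ ψ : EuclideanSpace ℝ (Fin n) → ℝ}
    (hφ : ContDiff ℝ ((n - 3) / 2 + 1 : ℕ) φ) (x : EuclideanSpace ℝ (Fin n)) :
    extendedSolution φ ψ (x, 0) = φ x := by
  rw [extendedSolution, timeDeriv_wavePotential_zero hn hn3 hφ, wavePotential_zero, add_zero]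

theorem timeDeriv_extendedSolution_zero (hn : Odd n) (hn3 : 3 ≤ n)
    {φ ψ : EuclideanSpace ℝ (Fin n) → ℝ}
    (hφ : ContDiff ℝ ((n - 3) / 2 + 3 : ℕ) φ) (hψ : ContDiff ℝ ((n - 3) / 2 + 2 : ℕ) ψ)
    (x : EuclideanSpace ℝ (Fin n)) : timeDeriv (extendedSolution φ ψ) (x, 0) = ψ x := by
  rw [timeDeriv_extendedSolution hφ hψ,
    timeDeriv_timeDeriv_wavePotential hn hn3 (hφ.of_le (by exact_mod_cast (by lia)))]
  beta_reduce
  rw [timeDeriv_wavePotential_zero hn hn3 (hψ.of_le (by exact_mod_cast (by lia)))]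
  simp

end EulerPoissonDarboux

/-! ### One-variable derivatives and the Laplacian as restrictions of space-time derivatives. -/

section Slices

variable {n : ℕ}

theorem hasDerivAt_time_slice {h : EuclideanSpace ℝ (Fin n) × ℝ → ℝ} (hh : Differentiable ℝ h)
    (x : EuclideanSpace ℝ (Fin n)) (t : ℝ) :
    HasDerivAt (fun s => h (x, s)) (timeDeriv h (x, t)) t := by
  have h1 : HasDerivAt (fun s : ℝ => (x, s)) (0, 1) t :=
    (hasDerivAt_const t x).prodMk (hasDerivAt_id t)
  exact (hh (x, t)).hasFDerivAt.comp_hasDerivAt t h1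

theorem dirDeriv_space_slice {h : EuclideanSpace ℝ (Fin n) × ℝ → ℝ} (hh : Differentiable ℝ h)
    (v : EuclideanSpace ℝ (Fin n)) (t : ℝ) :
    dirDeriv v (fun y => h (y, t)) = fun y => dirDeriv (v, 0) h (y, t) := by
  ext y
  have h1 : HasFDerivAt (fun y => h (y, t)) _ y :=
    (hh (y, t)).hasFDerivAt.comp y (hasFDerivAt_prodMk_left y t)
  rw [dirDeriv, h1.fderiv]
  simp [dirDeriv]

theorem laplacian_space_slice {h : EuclideanSpace ℝ (Fin n) × ℝ → ℝ} (hh : ContDiff ℝ 2 h)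
    (x : EuclideanSpace ℝ (Fin n)) (t : ℝ) :
    (Laplacian.laplacian (fun y => h (y, t)) : EuclideanSpace ℝ (Fin n) → ℝ) x =
      spaceLaplacian h (x, t) := by
  have hs : ContDiff ℝ 2 fun y => h (y, t) := hh.comp (by fun_prop)
  rw [InnerProductSpace.laplacian_eq_iteratedFDeriv_orthonormalBasis _
    (EuclideanSpace.basisFun (Fin n) ℝ)]
  refine Finset.sum_congr rfl fun i _ => ?_
  have h1 := dirDeriv_dirDeriv_apply hs (stdVec i) (stdVec i) x
  rw [dirDeriv_space_slice (hh.differentiable (by norm_num)), dirDeriv_space_slice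
    ((hh.dirDeriv (r := 1) (s := 2) le_rfl _).differentiable (by norm_num))] at h1
  beta_reduce at h1
  rw [h1, iteratedFDeriv_two_apply]
  simp [stdVec]

end Slices

/-! ### Identification of the explicit formula with the extended solution, and the case `n = 3`. -/

section WaveSolution

variable {n : ℕ}

theorem integral_sphereSurfaceMeasure {g : EuclideanSpace ℝ (Fin n) → ℝ} (hg : Continuous g)
    (x : EuclideanSpace ℝ (Fin n)) {t : ℝ} (ht : 0 ≤ t) :
    ∫ y, g y ∂(sphereSurfaceMeasure x t) =
      t ^ (n - 1) * ∫ ω : Metric.sphere (0 : EuclideanSpace ℝ (Fin n)) 1,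
        g (x + t • (ω : EuclideanSpace ℝ (Fin n)))
        ∂(volume : Measure (EuclideanSpace ℝ (Fin n))).toSphere := by
  have hm : Continuous fun ω : Metric.sphere (0 : EuclideanSpace ℝ (Fin n)) 1 =>
    x + t • (ω : EuclideanSpace ℝ (Fin n)) := by fun_prop
  rw [sphereSurfaceMeasure, integral_smul_measure, integral_map hm.measurable.aemeasurable
    hg.aestronglyMeasurable, ENNReal.toReal_ofReal (pow_nonneg ht _), smul_eq_mul]

theorem sphericalMean_eq_centeredMean {g : EuclideanSpace ℝ (Fin n) → ℝ} (hg : Continuous g)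
    (x : EuclideanSpace ℝ (Fin n)) {t : ℝ} (ht : 0 < t) :
    sphericalMean t g x = centeredMean g (x, t) := by
  rw [sphericalMean, integral_sphereSurfaceMeasure hg x ht.le, mul_inv, mul_assoc,
    inv_mul_cancel_left₀ (pow_pos ht _).ne']
  rfl

theorem contDiffOn_pow_mul_sphericalMean {r : ℕ} {f : EuclideanSpace ℝ (Fin n) → ℝ}
    (hf : ContDiff ℝ r f) (x : EuclideanSpace ℝ (Fin n)) :
    ContDiffOn ℝ r (fun t : ℝ => t ^ (n - 2) * sphericalMean t f x) (Ioi 0) := by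
  have h : ContDiff ℝ r fun t : ℝ => t ^ (n - 2) * centeredMean f (x, t) :=
    (contDiff_id.pow _).mul ((contDiff_centeredMean hf).comp (by fun_prop))
  exact h.contDiffOn.congr fun t ht => by rw [sphericalMean_eq_centeredMean hf.continuous x ht]

/-- One step is `t⁻¹ ∂_t (t ^ b w) = t ^ (b - 2) (b w + t w_t)` with `b = n - 2 - 2 i`. The bound on
`i` keeps the natural-number exponent from being truncated. -/
theorem iterate_invMulDeriv_sphericalMean {f : EuclideanSpace ℝ (Fin n) → ℝ} (i : ℕ)
    (hi : 2 * i + 3 ≤ n) (hf : ContDiff ℝ i f) (x : EuclideanSpace ℝ (Fin n)) {t : ℝ}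
    (ht : 0 < t) :
    (invMulDeriv^[i] fun s : ℝ => s ^ (n - 2) * sphericalMean s f x) t =
      t ^ (n - 2 - 2 * i) * shiftedMean f i (x, t) := by
  induction i generalizing t with
  | zero => simp [shiftedMean, sphericalMean_eq_centeredMean hf.continuous x ht]
  | succ i ih =>
    have hf' : ContDiff ℝ i f := hf.of_le (by exact_mod_cast Nat.le_succ i)
    have heq : (invMulDeriv^[i] fun s : ℝ => s ^ (n - 2) * sphericalMean s f x) =ᶠ[𝓝 t]
        fun s => s ^ (n - 2 - 2 * i) * shiftedMean f i (x, s) := by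
      filter_upwards [Ioi_mem_nhds ht] with s hs
      exact ih (by lia) hf' hs
    have hd : Differentiable ℝ (shiftedMean f i) :=
      (contDiff_shiftedMean (r := 1) i hf).differentiable (by norm_num)
    -- With this `m` the exponent is `m + 3` before the step and `m + 1` after it, free of
    -- subtraction.
    obtain ⟨m, hm⟩ : ∃ m, n = 2 * i + 4 + m + 1 := ⟨n - (2 * i + 5), by lia⟩
    have e1 : n - 2 - 2 * i = m + 2 + 1 := by lia
    have e2 : n - 2 - 2 * (i + 1) = m + 1 := by lia
    have e3 : (n : ℝ) - 2 - 2 * i = m + 2 + 1 := by rw [hm]; push_cast; ring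
    have hder := (hasDerivAt_pow (m + 2 + 1) t).mul (hasDerivAt_time_slice hd x t)
    rw [e1] at heq
    rw [Function.iterate_succ_apply', invMulDeriv, heq.deriv_eq, e2, shiftedMean, radialShift, e3]
    refine (congrArg (t⁻¹ * ·) hder.deriv).trans ?_
    push_cast
    field_simp
    ring

theorem iterate_invMulDeriv_eq_snd_mul (hn : Odd n) (hn3 : 3 ≤ n)
    {f : EuclideanSpace ℝ (Fin n) → ℝ} (hf : ContDiff ℝ ((n - 3) / 2 : ℕ) f)
    (x : EuclideanSpace ℝ (Fin n)) {t : ℝ} (ht : 0 < t) :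
    (invMulDeriv^[(n - 3) / 2] fun s : ℝ => s ^ (n - 2) * sphericalMean s f x) t =
      t * shiftedMean f ((n - 3) / 2) (x, t) := by
  have h1 : n - 2 - 2 * ((n - 3) / 2) = 1 := by
    obtain ⟨k, rfl⟩ := hn
    lia
  rw [iterate_invMulDeriv_sphericalMean _ (by lia) hf x ht, h1, pow_one]

theorem waveSolution_eq_extendedSolution (hn : Odd n) (hn3 : 3 ≤ n)
    {φ ψ : EuclideanSpace ℝ (Fin n) → ℝ} (hφ : ContDiff ℝ ((n - 3) / 2 + 1 : ℕ) φ)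
    (hψ : ContDiff ℝ ((n - 3) / 2 : ℕ) ψ) (x : EuclideanSpace ℝ (Fin n)) {t : ℝ} (ht : 0 < t) :
    waveSolution φ ψ x t = extendedSolution φ ψ (x, t) := by
  have hφ' : ContDiff ℝ ((n - 3) / 2 : ℕ) φ := hφ.of_le (by exact_mod_cast Nat.le_succ _)
  have hd : Differentiable ℝ (shiftedMean φ ((n - 3) / 2)) :=
    (contDiff_shiftedMean (r := 1) _ hφ).differentiable (by norm_num)
  have heq : (invMulDeriv^[(n - 3) / 2] fun s : ℝ => s ^ (n - 2) * sphericalMean s φ x) =ᶠ[𝓝 t]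
      fun s => s * shiftedMean φ ((n - 3) / 2) (x, s) := by
    filter_upwards [Ioi_mem_nhds ht] with s hs
    exact iterate_invMulDeriv_eq_snd_mul hn hn3 hφ' x hs
  rw [waveSolution, heq.deriv_eq, iterate_invMulDeriv_eq_snd_mul hn hn3 hψ x ht, extendedSolution,
    timeDeriv_wavePotential hφ, wavePotential,
    (hasDerivAt_time_slice (differentiable_snd.fun_mul hd) x t).deriv, timeDeriv_snd_mul hd]

theorem unitSphereArea_three : unitSphereArea 3 = 4 * Real.pi := by
  rw [unitSphereArea, Measure.toSphere_real_apply_univ, finrank_euclideanSpace_fin, Measure.real,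
    EuclideanSpace.volume_ball_fin_three, ENNReal.ofReal_one, one_pow, one_mul,
    ENNReal.toReal_ofReal (by positivity)]
  push_cast
  ring

theorem waveSolution_kirchhoff (φ ψ : EuclideanSpace ℝ (Fin 3) → ℝ)
    (x : EuclideanSpace ℝ (Fin 3)) (t : ℝ) :
    waveSolution φ ψ x t =
      deriv (fun s : ℝ => (4 * Real.pi * s)⁻¹ * ∫ y, φ y ∂(sphereSurfaceMeasure x s)) t +
        (4 * Real.pi * t)⁻¹ * ∫ y, ψ y ∂(sphereSurfaceMeasure x t) := by
  have h : ∀ f : EuclideanSpace ℝ (Fin 3) → ℝ,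
      (fun s : ℝ => s ^ (3 - 2) * sphericalMean s f x) =
        fun s => (4 * Real.pi * s)⁻¹ * ∫ y, f y ∂(sphereSurfaceMeasure x s) := by
    intro f
    ext s
    rw [sphericalMean, unitSphereArea_three]
    -- At `s = 0` both sides are `0`, the inverse of `0` being `0`; so the functions agree
    -- everywhere and so do their derivatives.
    rcases eq_or_ne s 0 with rfl | hs
    · simp
    · have := Real.pi_ne_zero
      norm_num
      field_simp
  have h0 : (3 - 3) / 2 = 0 := rfl
  have h1 : waveConst 3 = 1 := by simp [waveConst]
  rw [waveSolution, h0, Function.iterate_zero, id, id, h, h1, one_mul, one_mul]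
  exact congrArg (_ + ·) (congrFun (h ψ) t)

/-- No shift occurs and `c_3 = 1`, so the solution is `t ∂_t M φ + M φ + t M ψ`. On the sphere `y -
x = t ω`, which turns `t ∂_t M φ` into the mean of `Dφ(y)(y - x)`. -/
theorem extendedSolution_three {φ ψ : EuclideanSpace ℝ (Fin 3) → ℝ} (hφ : ContDiff ℝ 1 φ)
    (hψ : Continuous ψ) (x : EuclideanSpace ℝ (Fin 3)) {t : ℝ} (ht : 0 < t) :
    extendedSolution φ ψ (x, t) = (4 * Real.pi * t ^ 2)⁻¹ *
      ∫ y, (t * ψ y + φ y + fderiv ℝ φ y (y - x)) ∂(sphereSurfaceMeasure x t) := by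
  have hφ' : Continuous (fderiv ℝ φ) := hφ.continuous_fderiv (by norm_num)
  have hφc := hφ.continuous
  have hy : Continuous fun ω : Metric.sphere (0 : EuclideanSpace ℝ (Fin 3)) 1 =>
    x + t • (ω : EuclideanSpace ℝ (Fin 3)) := by fun_prop
  have hω := continuous_subtype_val
    (p := fun x => x ∈ Metric.sphere (0 : EuclideanSpace ℝ (Fin 3)) 1)
  have hg : Continuous fun y => t * ψ y + φ y + fderiv ℝ φ y (y - x) :=
    ((continuous_const.mul hψ).add hφc).add (hφ'.clm_apply (by fun_prop))
  have i1 := ((hψ.comp hy).integrable_of_compactSpace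
    (μ := (volume : Measure (EuclideanSpace ℝ (Fin 3))).toSphere)).const_mul t
  have i2 := (hφc.comp hy).integrable_of_compactSpace
    (μ := (volume : Measure (EuclideanSpace ℝ (Fin 3))).toSphere)
  have i3 := (((hφ'.comp hy).clm_apply hω).integrable_of_compactSpace
    (μ := (volume : Measure (EuclideanSpace ℝ (Fin 3))).toSphere)).const_mul t
  rw [integral_sphereSurfaceMeasure hg x ht.le]
  simp only [add_sub_cancel_left, map_smul, smul_eq_mul]
  have hs := integral_add (i1.add i2) i3
  have hs' := integral_add i1 i2
  simp only [Pi.add_apply, Function.comp_apply] at hs hs'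
  rw [hs, hs', integral_const_mul, integral_const_mul, extendedSolution,
    timeDeriv_wavePotential (by simpa using hφ), wavePotential]
  simp only [Nat.sub_self, Nat.zero_div, shiftedMean]
  rw [timeDeriv, dirDeriv_centeredMean hφ]
  simp only [centeredMean, unitSphereArea_three, zero_add, one_smul, waveConst]
  have := Real.pi_ne_zero
  norm_num
  field_simp
  ring

end WaveSolution

end

/-! ### Assembly of the theorem. -/

theorem mainTheorem1 (n : ℕ) (hn : Odd n) (hn3 : 3 ≤ n)
    (φ ψ : EuclideanSpace ℝ (Fin n) → ℝ)
    (hφ : ContDiff ℝ (((n + 3) / 2 : ℕ) : WithTop ℕ∞) φ)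
    (hψ : ContDiff ℝ (((n + 1) / 2 : ℕ) : WithTop ℕ∞) ψ) :
    -- the derivatives in the formula exist
    (∀ x, ContDiffOn ℝ (((n - 1) / 2 : ℕ) : WithTop ℕ∞)
      (fun t : ℝ => t ^ (n - 2) * sphericalMean t φ x) (Ioi 0)) ∧
    (∀ x, ContDiffOn ℝ (((n - 3) / 2 : ℕ) : WithTop ℕ∞)
      (fun t : ℝ => t ^ (n - 2) * sphericalMean t ψ x) (Ioi 0)) ∧
    -- `u` is a `C²` solution in the open upper half-space
    ContDiffOn ℝ 2 (fun p : EuclideanSpace ℝ (Fin n) × ℝ => waveSolution φ ψ p.1 p.2)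
      {p | 0 < p.2} ∧
    (∀ (x : EuclideanSpace ℝ (Fin n)) (t : ℝ), 0 < t →
      iteratedDeriv 2 (fun s : ℝ => waveSolution φ ψ x s) t =
        (Laplacian.laplacian (fun y => waveSolution φ ψ y t) : EuclideanSpace ℝ (Fin n) → ℝ) x) ∧
    -- the initial conditions, as limits from the open half-space
    (∀ x₀ : EuclideanSpace ℝ (Fin n),
      Tendsto (fun p : EuclideanSpace ℝ (Fin n) × ℝ => waveSolution φ ψ p.1 p.2)
        (𝓝[{p | 0 < p.2}] (x₀, 0)) (𝓝 (φ x₀))) ∧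
    (∀ x₀ : EuclideanSpace ℝ (Fin n),
      Tendsto (fun p : EuclideanSpace ℝ (Fin n) × ℝ =>
          deriv (fun s : ℝ => waveSolution φ ψ p.1 s) p.2)
        (𝓝[{p | 0 < p.2}] (x₀, 0)) (𝓝 (ψ x₀))) ∧
    -- `u` is `C²` up to the boundary, where it takes the initial data
    (∃ v : EuclideanSpace ℝ (Fin n) × ℝ → ℝ,
      ContDiffOn ℝ 2 v {p | 0 ≤ p.2} ∧
      (∀ (x : EuclideanSpace ℝ (Fin n)) (t : ℝ), 0 < t → v (x, t) = waveSolution φ ψ x t) ∧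
      (∀ x : EuclideanSpace ℝ (Fin n), v (x, 0) = φ x) ∧
      (∀ x : EuclideanSpace ℝ (Fin n),
        HasDerivWithinAt (fun t : ℝ => v (x, t)) (ψ x) (Ici 0) 0)) ∧
    -- Kirchhoff's formula, in its two usual forms
    (n = 3 → ∀ (x : EuclideanSpace ℝ (Fin n)) (t : ℝ), 0 < t →
      waveSolution φ ψ x t =
          deriv (fun s : ℝ => (4 * Real.pi * s)⁻¹ * ∫ y, φ y ∂(sphereSurfaceMeasure x s)) t +
            (4 * Real.pi * t)⁻¹ * ∫ y, ψ y ∂(sphereSurfaceMeasure x t) ∧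
      waveSolution φ ψ x t =
          (4 * Real.pi * t ^ 2)⁻¹ *
            ∫ y, (t * ψ y + φ y + fderiv ℝ φ y (y - x)) ∂(sphereSurfaceMeasure x t)) := by
  -- Of the derivatives of `φ`, `(n - 3) / 2` go into the shifts, one into the outer `∂_t`, and two
  -- remain for `C²`; `ψ` needs one fewer.
  have hφ' : ContDiff ℝ ((n - 3) / 2 + 3 : ℕ) φ := by
    rwa [show (n + 3) / 2 = (n - 3) / 2 + 3 by lia] at hφ
  have hψ' : ContDiff ℝ ((n - 3) / 2 + 2 : ℕ) ψ := by
    rwa [show (n + 1) / 2 = (n - 3) / 2 + 2 by lia] at hψ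
  have hφ1 : ContDiff ℝ ((n - 3) / 2 + 1 : ℕ) φ := hφ'.of_le (by exact_mod_cast (by lia))
  have hψ0 : ContDiff ℝ ((n - 3) / 2 : ℕ) ψ := hψ'.of_le (by exact_mod_cast (by lia))
  have heq : ∀ x, ∀ {t : ℝ}, 0 < t → waveSolution φ ψ x t = extendedSolution φ ψ (x, t) :=
    fun x _ ht => waveSolution_eq_extendedSolution hn hn3 hφ1 hψ0 x ht
  have hv : ContDiff ℝ 2 (extendedSolution φ ψ) := contDiff_extendedSolution hφ' hψ'
  have hvd : Differentiable ℝ (extendedSolution φ ψ) := hv.differentiable (by norm_num)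
  have hvt : ContDiff ℝ 1 (timeDeriv (extendedSolution φ ψ)) :=
    hv.timeDeriv (r := 1) (s := 2) le_rfl
  have hder : ∀ x, ∀ {t : ℝ}, 0 < t →
      deriv (fun s => waveSolution φ ψ x s) t = timeDeriv (extendedSolution φ ψ) (x, t) := by
    intro x t ht
    have : (fun s => waveSolution φ ψ x s) =ᶠ[𝓝 t] fun s => extendedSolution φ ψ (x, s) := by
      filter_upwards [Ioi_mem_nhds ht] with s hs using heq x hs
    rw [this.deriv_eq, (hasDerivAt_time_slice hvd x t).deriv]
  refine ⟨fun x => contDiffOn_pow_mul_sphericalMean (hφ.of_le (by exact_mod_cast (by lia))) x,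
    fun x => contDiffOn_pow_mul_sphericalMean (hψ.of_le (by exact_mod_cast (by lia))) x,
    hv.contDiffOn.congr fun p hp => heq p.1 hp, ?_, ?_, ?_,
    ⟨extendedSolution φ ψ, hv.contDiffOn, fun x t ht => (heq x ht).symm,
      extendedSolution_zero hn hn3 hφ1, fun x => ?_⟩, ?_⟩
  · intro x t ht
    have h1 : deriv (fun s => waveSolution φ ψ x s) =ᶠ[𝓝 t]
        fun s => timeDeriv (extendedSolution φ ψ) (x, s) := by
      filter_upwards [Ioi_mem_nhds ht] with s hs using hder x hs
    have h2 : (fun y => waveSolution φ ψ y t) = fun y => extendedSolution φ ψ (y, t) :=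
      funext fun y => heq y ht
    rw [iteratedDeriv_succ, iteratedDeriv_one, h1.deriv_eq,
      (hasDerivAt_time_slice (hvt.differentiable (by norm_num)) x t).deriv, h2,
      laplacian_space_slice hv, extendedSolution_wave hn hn3 hφ' hψ']
  · intro x₀
    rw [← extendedSolution_zero (ψ := ψ) hn hn3 hφ1 x₀]
    refine (hv.continuous.tendsto (x₀, 0)).mono_left nhdsWithin_le_nhds |>.congr' ?_
    filter_upwards [self_mem_nhdsWithin] with p hp using (heq p.1 hp).symm
  · intro x₀
    rw [← timeDeriv_extendedSolution_zero hn hn3 hφ' hψ' x₀]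
    refine (hvt.continuous.tendsto (x₀, 0)).mono_left nhdsWithin_le_nhds |>.congr' ?_
    filter_upwards [self_mem_nhdsWithin] with p hp using (hder p.1 hp).symm
  · have h := hasDerivAt_time_slice hvd x 0
    rw [timeDeriv_extendedSolution_zero hn hn3 hφ' hψ' x] at h
    exact h.hasDerivWithinAt
  · rintro rfl x t ht
    refine ⟨waveSolution_kirchhoff φ ψ x t, ?_⟩
    rw [heq x ht, extendedSolution_three (hφ.of_le (by norm_num)) hψ.continuous x ht]
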